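/- Let $\mathbb K$ be $\mathbb R$ or $\mathbb C$; sequences are indexed by $n\ge 0$ and have entries in $\mathbb K$, and a series $\sum_{j=0}^\infty$ is understood as the limit of its partial sums. Let $c_0$, $c$, $\ell_\infty$ be the sets of null, convergent and bounded sequences. Let $r,s,t$ be sequences with $r_n\neq 0$ and $t_n\ne 0$ for all $n$ and $s_0\neq 0$, and put $$c_0(r,s,t;\Delta)=\Big\{x:\ \Big(\tfrac1{r_n}\sum_{k=0}^n s_{n-k}t_k(x_k-x_{k-1})\Big)_{n}\in c_0\Big\},\qquad x_{-1}=0 .$$ For sets $U,V$ of sequences, an infinite matrix $A=(a_{nk})_{n,k\ge0}$ over $\mathbb K$ belongs to $(U,V)$ if for every $x\in U$ all the series $(Ax)_n=\sum_{k=0}^\infty a_{nk}x_k$ converge and $((Ax)_n)_n\in V$. Let $D^{(s)}_n=s_0^{-(n+1)}\det(h_{ij})_{1\le i,j\le n}$, where $h_{ij}=s_{i-j+1}$ if $j\le i+1$ and $h_{ij}=0$ otherwise (so $D_0^{(s)}=1/s_0$), and $$s_{jk}=\sum_{l=0}^{j-k}(-1)^l\frac{D^{(s)}_l}{t_{l+k}}\,r_k\quad(0\le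 k\le j),\qquad s_{jk}=0\quad (k>j),$$ which are the entries of the inverse of the triangle $x\mapsto\big(\frac1{r_n}\sum_{k=0}^n s_{n-k}t_k(x_k-x_{k-1})\big)_n$. For the rows $A_n=(a_{nj})_j$ of $A$ put $$R_k(A_n)=\sum_{j=0}^\infty s_{jk}a_{nj}=\sum_{j=k}^\infty s_{jk}a_{nj},\qquad w^{A_n}_{mk}=\sum_{j=m}^\infty a_{nj}s_{jk}\ \ (0\le k\le m),\qquad w^{A_n}_{mk}=0\ \ (k>m).$$ Consider the conditions (4.12) $\sup_n\sum_{k=0}^\infty|R_k(A_n)|<\infty$; (4.13) $\lim_{n\to\infty}R_k(A_n)=0$ for all $k$; (4.14) $\sup_m\sum_{k=0}^m|w^{A_n}_{mk}|<\infty$ for all $n$; (4.15) $\lim_{m\to\infty}w^{A_n}_{mk}=0$ for all $n,k$; (4.16) $\lim_{n\to\infty}R_k(A_n)$ exists for all $k$; each of them including the requirement that the series defining $R_k(A_n)$ converge for all $n,k$ (then so do those defining $w^{A_n}_{mk}$). Then: (a) $A\in(c_0(r,s,t;\Delta),c_0)$ if and only if (4.12), (4.13), (4.14) and (4.15) hold.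 (b) $A\in(c_0(r,s,t;\Delta),c)$ if and only if (4.12), (4.14), (4.15) and (4.16) hold. (c) $A\in(c_0(r,s,t;\Delta),\ell_\infty)$ if and only if (4.12), (4.14) and (4.15) hold. (d) Let $n,k\ge 0$ be such that the series $\sum_{j=0}^\infty a_{nj}$ and $\sum_{l=0}^\infty(-1)^l\frac{D^{(s)}_l}{t_{l+k}}\sum_{j=k+l}^\infty a_{nj}$ converge, and for $m\ge k$ put $$\tilde w_{m}=r_k\Big[\sum_{l=0}^{m-k}(-1)^l\frac{D_l^{(s)}}{t_{l+k}}\sum_{j=m}^\infty a_{nj}+\sum_{l=m-k+1}^\infty(-1)^l\frac{D_l^{(s)}}{t_{l+k}}\sum_{j=k+l}^\infty a_{nj}\Big].$$ If $\lim_{m\to\infty}\tilde w_m=0$, then the series defining $R_k(A_n)$ converges, $w^{A_n}_{mk}=\tilde w_m$ for all $m\ge k$, and $$R_k(A_n)=r_k\Big[\frac{a_{nk}}{s_0t_k}+\Big(\frac{D_0^{(s)}}{t_k}-\frac{D_1^{(s)}}{t_{k+1}}\Big)\sum_{j=k+1}^\infty a_{nj}+\sum_{l=2}^\infty(-1)^l\frac{D_l^{(s)}}{t_{l+k}}\sum_{j=k+l}^\infty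 a_{nj}\Big].$$ -/

import Mathlib

open Filter Topology
open scoped ENNReal

namespace GenMeans

variable {𝕜 : Type*} [RCLike 𝕜]

/-- Ordinary (conditional) convergence of the series `∑_{j=0}^∞ f j`: the partial sums converge. -/
def SeriesConv (f : ℕ → 𝕜) : Prop :=
  Summable f (SummationFilter.conditional ℕ)

/-- The sum `∑_{j=0}^∞ f j`, that is, the limit of the partial sums (when it exists). -/
noncomputable def seriesSum (f : ℕ → 𝕜) : 𝕜 :=
  tsum f (SummationFilter.conditional ℕ)

/-- Null sequences. -/
def c0 (𝕜 : Type*) [RCLike 𝕜] : Set (ℕ → 𝕜) :=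
  {x | Tendsto x atTop (𝓝 0)}

/-- Convergent sequences. -/
def c (𝕜 : Type*) [RCLike 𝕜] : Set (ℕ → 𝕜) :=
  {x | ∃ l : 𝕜, Tendsto x atTop (𝓝 l)}

/-- Bounded sequences. -/
def linf (𝕜 : Type*) [RCLike 𝕜] : Set (ℕ → 𝕜) :=
  {x | ∃ M : ℝ, ∀ n, ‖x n‖ ≤ M}

/-- The class `(U, V)` of infinite matrices mapping `U` into `V`: for every `x ∈ U` all the series
`(A x)_n = ∑_k a_{nk} x_k` converge and the sequence `A x` belongs to `V`. -/
def MapsInto (A : ℕ → ℕ → 𝕜) (U V : Set (ℕ → 𝕜)) : Prop :=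
  ∀ x ∈ U, (∀ n, SeriesConv fun k => A n k * x k) ∧
    (fun n => seriesSum fun k => A n k * x k) ∈ V

/-- The backward difference `Δ x_k = x_k - x_{k-1}`, with `x_{-1} = 0`. -/
def diff (x : ℕ → 𝕜) : ℕ → 𝕜
  | 0 => x 0
  | k + 1 => x (k + 1) - x k

/-- The sequence `A(r,s,t;Δ) x` of generalized means of `Δ x`. -/
noncomputable def mean (r s t : ℕ → 𝕜) (x : ℕ → 𝕜) (n : ℕ) : 𝕜 :=
  (1 / r n) * ∑ k ∈ Finset.range (n + 1), s (n - k) * t k * diff x k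

/-- The space `c_0(r,s,t;Δ)`. -/
def c0Mean (r s t : ℕ → 𝕜) : Set (ℕ → 𝕜) :=
  {x | mean r s t x ∈ c0 𝕜}

/-- `D_n^{(s)}`: the `n × n` determinant with `(i,j)` entry `s_{i-j+1}` (`0` above the
superdiagonal), divided by `s_0^{n+1}`; in particular `D_0^{(s)} = 1 / s_0`. -/
noncomputable def D (s : ℕ → 𝕜) (n : ℕ) : 𝕜 :=
  (1 / s 0 ^ (n + 1)) *
    (Matrix.of fun i j : Fin n =>
      if (j : ℕ) ≤ (i : ℕ) + 1 then s ((i : ℕ) + 1 - (j : ℕ)) else 0).det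

/-- The entry `s_{jk}` of the inverse `S` of the triangle `A(r,s,t;Δ)`. -/
noncomputable def invEntry (r s t : ℕ → 𝕜) (j k : ℕ) : 𝕜 :=
  if k ≤ j then
    ∑ l ∈ Finset.range (j - k + 1), (-1) ^ l * (D s l / t (l + k)) * r k
  else 0

/-- The series `R_k(a) = ∑_j s_{jk} a_j` converges for every `k`. -/
def RConv (r s t : ℕ → 𝕜) (a : ℕ → 𝕜) : Prop :=
  ∀ k, SeriesConv fun j => invEntry r s t j k * a j

/-- `R_k(a) = ∑_j s_{jk} a_j`, i.e. `R(a) = Sᵗ a`. -/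
noncomputable def R (r s t : ℕ → 𝕜) (a : ℕ → 𝕜) (k : ℕ) : 𝕜 :=
  seriesSum fun j => invEntry r s t j k * a j

/-- The triangle `W^a`: `w_{mk} = ∑_{j=m}^∞ a_j s_{jk}` for `k ≤ m`, and `0` for `k > m`. -/
noncomputable def W (r s t : ℕ → 𝕜) (a : ℕ → 𝕜) (m k : ℕ) : 𝕜 :=
  if k ≤ m then seriesSum fun i => a (m + i) * invEntry r s t (m + i) k else 0

/-- The tail `∑_{j=m}^∞ a_j`. -/
noncomputable def tail (a : ℕ → 𝕜) (m : ℕ) : 𝕜 :=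
  seriesSum fun i => a (m + i)

/-- The general term `(-1)^l (D_l^{(s)} / t_{l+k}) ∑_{j=k+l}^∞ a_j` of the rearranged series. -/
noncomputable def rearrTerm (s t : ℕ → 𝕜) (a : ℕ → 𝕜) (k l : ℕ) : 𝕜 :=
  (-1) ^ l * (D s l / t (l + k)) * tail a (k + l)

/-- The rearranged expression for `R_k(a)`. -/
noncomputable def RRearr (r s t : ℕ → 𝕜) (a : ℕ → 𝕜) (k : ℕ) : 𝕜 :=
  r k * (a k / (s 0 * t k) + (D s 0 / t k - D s 1 / t (k + 1)) * tail a (k + 1)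
    + seriesSum fun i => rearrTerm s t a k (i + 2))

/-- The rearranged expression for `w_{mk}`, `k ≤ m`. -/
noncomputable def WRearr (r s t : ℕ → 𝕜) (a : ℕ → 𝕜) (m k : ℕ) : 𝕜 :=
  r k * ((∑ l ∈ Finset.range (m - k + 1), (-1) ^ l * (D s l / t (l + k))) * tail a m
    + seriesSum fun i => rearrTerm s t a k (m - k + 1 + i))

/-- `sup_n ∑_k |R_k(A_n)| < ∞`. -/
def RRowsBounded (r s t : ℕ → 𝕜) (A : ℕ → ℕ → 𝕜) : Prop :=
  ⨆ n, ∑' k, ‖R r s t (A n) k‖ₑ < ∞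

/-- `lim_n R_k(A_n) = 0` for all `k`. -/
def RColsNull (r s t : ℕ → 𝕜) (A : ℕ → ℕ → 𝕜) : Prop :=
  ∀ k, Tendsto (fun n => R r s t (A n) k) atTop (𝓝 0)

/-- `lim_n R_k(A_n)` exists for all `k`. -/
def RColsConv (r s t : ℕ → 𝕜) (A : ℕ → ℕ → 𝕜) : Prop :=
  ∀ k, ∃ l : 𝕜, Tendsto (fun n => R r s t (A n) k) atTop (𝓝 l)

/-- `sup_m ∑_{k=0}^m |w_{mk}^{A_n}| < ∞` for all `n`. -/
def WRowsBounded (r s t : ℕ → 𝕜) (A : ℕ → ℕ → 𝕜) : Prop :=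
  ∀ n, ⨆ m, ∑ k ∈ Finset.range (m + 1), ‖W r s t (A n) m k‖ₑ < ∞

/-- `lim_m w_{mk}^{A_n} = 0` for all `n, k`. -/
def WColsNull (r s t : ℕ → 𝕜) (A : ℕ → ℕ → 𝕜) : Prop :=
  ∀ n k, Tendsto (fun m => W r s t (A n) m k) atTop (𝓝 0)

end GenMeans

/-! The mean is inverted with power series: with `f(X) = ∑ s_n Xⁿ`, passing from `Δ x` to the mean
of `x` multiplies by `t`, then by `f`, and divides by `r`, and Cramer's rule for `f⁻¹ f = 1` gives
`(-1)ⁿ D_n` as the coefficients of `f⁻¹`. Hence `c_0(r,s,t;Δ)` is the image of `c_0` under the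
triangle `S = (s_{jk})`.

For a null sequence `y`, the partial sums of `∑_j a_j (S y)_j` are the values at `y` of the matrix
of partial sums of the series for `Sᵗ a`. By Banach–Steinhaus on `c_0` they converge for every `y`
if and only if that matrix has convergent columns and bounded rows in `ℓ₁`, and then the limit is
`∑_k (Sᵗ a)_k y_k`. The partial sums differ from `Sᵗ a` by the remainders `W^a`, so that `A` maps
`S c_0` into `V` if and only if the series for all `R_k(A_n)` converge, `(R_k(A_n))` maps `c_0` into
`V` and every `W^{A_n}` maps `c_0` into itself.

The expression for `R_k(a)` in terms of the tails of `∑ a_j` is a telescoping summation by parts. -/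

namespace GenMeans

variable {𝕜 : Type*} [RCLike 𝕜]

section Series

variable {f : ℕ → 𝕜} {a : 𝕜}

theorem hasSum_conditional_iff :
    HasSum f a (SummationFilter.conditional ℕ) ↔
      Tendsto (fun n => ∑ i ∈ Finset.range n, f i) atTop (𝓝 a) := by
  rw [HasSum, SummationFilter.conditional_filter_eq_map_range, tendsto_map'_iff]
  rfl

theorem seriesConv_iff :
    SeriesConv f ↔ ∃ a, Tendsto (fun n => ∑ i ∈ Finset.range n, f i) atTop (𝓝 a) := by
  simp only [SeriesConv, Summable, hasSum_conditional_iff]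

theorem seriesConv_of_tendsto
    (h : Tendsto (fun n => ∑ i ∈ Finset.range n, f i) atTop (𝓝 a)) : SeriesConv f :=
  seriesConv_iff.2 ⟨a, h⟩

theorem seriesSum_eq_of_tendsto
    (h : Tendsto (fun n => ∑ i ∈ Finset.range n, f i) atTop (𝓝 a)) : seriesSum f = a :=
  (hasSum_conditional_iff.2 h).tsum_eq

theorem SeriesConv.tendsto_sum_range (h : SeriesConv f) :
    Tendsto (fun n => ∑ i ∈ Finset.range n, f i) atTop (𝓝 (seriesSum f)) :=
  hasSum_conditional_iff.1 (Summable.hasSum h)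

theorem seriesConv_of_eq_zero {m : ℕ} (h : ∀ k, m ≤ k → f k = 0) : SeriesConv f :=
  (hasSum_sum_of_ne_finset_zero (s := Finset.range m) fun k hk => h k (by simpa using hk)).summable

theorem seriesSum_eq_sum_range {m : ℕ} (h : ∀ k, m ≤ k → f k = 0) :
    seriesSum f = ∑ k ∈ Finset.range m, f k :=
  tsum_eq_sum fun k hk => h k (by simpa using hk)

theorem SeriesConv.seriesSum_add_left (h : SeriesConv f) (m : ℕ) :
    (seriesSum fun i => f (m + i)) = seriesSum f - ∑ i ∈ Finset.range m, f i := by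
  refine seriesSum_eq_of_tendsto ?_
  have hshift := (h.tendsto_sum_range.comp (tendsto_add_atTop_nat m)).sub_const
    (∑ i ∈ Finset.range m, f i)
  refine hshift.congr fun n => ?_
  rw [Function.comp_apply, add_comm n m, Finset.sum_range_add, add_sub_cancel_left]

theorem SeriesConv.seriesSum_eq_add (h : SeriesConv f) (m : ℕ) :
    (seriesSum fun i => f (m + i)) = f m + seriesSum fun i => f (m + 1 + i) := by
  rw [h.seriesSum_add_left, h.seriesSum_add_left, Finset.sum_range_succ]
  ring

end Series

section NullSequences

theorem seriesSum_mul_single (b : ℕ → 𝕜) (k : ℕ) :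
    (seriesSum fun i => b i * Pi.single (M := fun _ => 𝕜) k 1 i) = b k := by
  rw [seriesSum, tsum_eq_single k fun i hi => by rw [Pi.single_eq_of_ne hi, mul_zero],
    Pi.single_eq_same, mul_one]

theorem mem_c0_of_eq_zero {y : ℕ → 𝕜} {m : ℕ} (h : ∀ k, m ≤ k → y k = 0) : y ∈ c0 𝕜 :=
  tendsto_const_nhds.congr' <| (eventually_ge_atTop m).mono fun k hk => (h k hk).symm

theorem single_mem_c0 (k : ℕ) : Pi.single (M := fun _ => 𝕜) k 1 ∈ c0 𝕜 :=
  mem_c0_of_eq_zero (m := k + 1) fun i hi => Pi.single_eq_of_ne (by omega) 1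

theorem c0_subset_c : c0 𝕜 ⊆ c 𝕜 := fun _ hx => ⟨0, hx⟩

theorem c_subset_linf : c 𝕜 ⊆ linf 𝕜 := fun _ ⟨_, hx⟩ => by
  obtain ⟨M, hM⟩ := hx.norm.bddAbove_range
  exact ⟨M, fun n => hM ⟨n, rfl⟩⟩

end NullSequences

section RowsBounded

variable {ι κ : Type*} {B : ι → ℕ → 𝕜}

/-- The rows of `B` form a bounded family in `ℓ₁`: `sup_i ∑_k |b_{ik}| < ∞`. This is the common form
of the conditions on the matrices `(R_k(A_n))_{n,k}` and `W^{A_n}`. -/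
def RowsBounded (B : ι → ℕ → 𝕜) : Prop :=
  ⨆ i, ∑' k, ‖B i k‖ₑ < ∞

theorem rowsBounded_iff :
    RowsBounded B ↔ ∃ C : ℝ, ∀ i K, ∑ k ∈ Finset.range K, ‖B i k‖ ≤ C := by
  have hsum (i K) : ∑ k ∈ Finset.range K, ‖B i k‖ₑ =
      ENNReal.ofReal (∑ k ∈ Finset.range K, ‖B i k‖) := by
    simp only [ENNReal.ofReal_sum_of_nonneg fun _ _ => norm_nonneg _, ofReal_norm]
  simp only [RowsBounded, ENNReal.tsum_eq_iSup_nat, hsum]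
  constructor
  · intro h
    exact ⟨_, fun i K => (ENNReal.ofReal_le_iff_le_toReal h.ne).1 <|
      le_iSup₂ (f := fun i K => ENNReal.ofReal (∑ k ∈ Finset.range K, ‖B i k‖)) i K⟩
  · rintro ⟨C, hC⟩
    exact (iSup₂_le fun i K => ENNReal.ofReal_le_ofReal (hC i K)).trans_lt ENNReal.ofReal_lt_top

theorem RowsBounded.of_norm_le_add {B₁ B₂ : ι → ℕ → 𝕜} (h₁ : RowsBounded B₁)
    (h₂ : RowsBounded B₂) (h : ∀ i k, ‖B i k‖ ≤ ‖B₁ i k‖ + ‖B₂ i k‖) : RowsBounded B := by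
  obtain ⟨C₁, hC₁⟩ := rowsBounded_iff.1 h₁
  obtain ⟨C₂, hC₂⟩ := rowsBounded_iff.1 h₂
  refine rowsBounded_iff.2 ⟨C₁ + C₂, fun i K => ?_⟩
  calc ∑ k ∈ Finset.range K, ‖B i k‖
      ≤ ∑ k ∈ Finset.range K, (‖B₁ i k‖ + ‖B₂ i k‖) := Finset.sum_le_sum fun k _ => h i k
    _ ≤ C₁ + C₂ := by
      rw [Finset.sum_add_distrib]
      exact add_le_add (hC₁ i K) (hC₂ i K)

theorem RowsBounded.const_of_tendsto {l : Filter ι} [l.NeBot] {b : ℕ → 𝕜} (hB : RowsBounded B)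
    (hb : ∀ k, Tendsto (fun i => B i k) l (𝓝 (b k))) : RowsBounded fun _ : κ => b := by
  obtain ⟨C, hC⟩ := rowsBounded_iff.1 hB
  refine rowsBounded_iff.2 ⟨C, fun _ K => ?_⟩
  exact le_of_tendsto (tendsto_finsetSum _ fun k _ => (hb k).norm) (.of_forall fun i => hC i K)

theorem RowsBounded.uniformCauchySeqOn (hB : RowsBounded B) {y : ℕ → 𝕜} (hy : y ∈ c0 𝕜) :
    UniformCauchySeqOn (fun N i => ∑ k ∈ Finset.range N, B i k * y k) atTop Set.univ := by
  obtain ⟨C, hC⟩ := rowsBounded_iff.1 hB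
  rw [Metric.uniformCauchySeqOn_iff]
  intro ε hε
  obtain ⟨δ, hδ, hCδ⟩ := exists_pos_mul_lt hε C
  obtain ⟨K, hK⟩ := Metric.tendsto_atTop.1 hy δ hδ
  have hle {m n : ℕ} (hm : K ≤ m) (hmn : m ≤ n) (i : ι) :
      dist (∑ k ∈ Finset.range m, B i k * y k) (∑ k ∈ Finset.range n, B i k * y k) < ε := by
    rw [dist_comm, dist_eq_norm, ← Finset.sum_Ico_eq_sub _ hmn]
    calc ‖∑ k ∈ Finset.Ico m n, B i k * y k‖
        ≤ ∑ k ∈ Finset.Ico m n, ‖B i k‖ * δ := by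
          refine norm_sum_le_of_le _ fun k hk => ?_
          have hyk : ‖y k‖ < δ := by
            simpa only [dist_zero_right] using hK k (hm.trans (Finset.mem_Ico.1 hk).1)
          rw [norm_mul]
          gcongr
      _ ≤ (∑ k ∈ Finset.range n, ‖B i k‖) * δ := by
          rw [← Finset.sum_mul, Finset.range_eq_Ico]
          gcongr
          exact Nat.zero_le m
      _ ≤ C * δ := by gcongr; exact hC i n
      _ < ε := hCδ
  refine ⟨K, fun m hm n hn i _ => ?_⟩
  rcases le_total m n with hmn | hnm
  · exact hle hm hmn i
  · rw [dist_comm]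
    exact hle hn hnm i

theorem RowsBounded.seriesConv_mul (hB : RowsBounded B) {y : ℕ → 𝕜} (hy : y ∈ c0 𝕜) (i : ι) :
    SeriesConv fun k => B i k * y k :=
  seriesConv_iff.2 <|
    cauchySeq_tendsto_of_complete <| (hB.uniformCauchySeqOn hy).cauchySeq (Set.mem_univ i)

theorem RowsBounded.tendsto_seriesSum_mul {l : Filter ι} [l.NeBot] {b : ℕ → 𝕜}
    (hB : RowsBounded B) (hb : ∀ k, Tendsto (fun i => B i k) l (𝓝 (b k))) {y : ℕ → 𝕜}
    (hy : y ∈ c0 𝕜) :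
    Tendsto (fun i => seriesSum fun k => B i k * y k) l (𝓝 (seriesSum fun k => b k * y k)) := by
  have hunif : TendstoUniformlyOn (fun N i => ∑ k ∈ Finset.range N, B i k * y k)
      (fun i => seriesSum fun k => B i k * y k) atTop Set.univ :=
    (hB.uniformCauchySeqOn hy).tendstoUniformlyOn_of_tendsto fun i _ =>
      (hB.seriesConv_mul hy i).tendsto_sum_range
  have hlim : SeriesConv fun k => b k * y k :=
    (hB.const_of_tendsto (κ := Unit) hb).seriesConv_mul hy ()
  exact (tendstoUniformlyOn_univ.1 hunif).tendsto_of_eventually_tendsto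
    (.of_forall fun N => tendsto_finsetSum _ fun k _ => (hb k).mul_const (y k))
    hlim.tendsto_sum_range

theorem RowsBounded.exists_norm_seriesSum_mul_le (hB : RowsBounded B) {y : ℕ → 𝕜}
    (hy : y ∈ c0 𝕜) : ∃ M : ℝ, ∀ i, ‖seriesSum fun k => B i k * y k‖ ≤ M := by
  obtain ⟨C, hC⟩ := rowsBounded_iff.1 hB
  obtain ⟨M, hM⟩ := c_subset_linf (c0_subset_c hy)
  have hM₀ : 0 ≤ M := (norm_nonneg _).trans (hM 0)
  refine ⟨C * M, fun i => ?_⟩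
  refine le_of_tendsto (hB.seriesConv_mul hy i).tendsto_sum_range.norm (.of_forall fun K => ?_)
  calc ‖∑ k ∈ Finset.range K, B i k * y k‖
      ≤ ∑ k ∈ Finset.range K, ‖B i k‖ * M := by
        refine norm_sum_le_of_le _ fun k _ => ?_
        rw [norm_mul]
        gcongr
        exact hM k
    _ ≤ C * M := by
        rw [← Finset.sum_mul]
        gcongr
        exact hC i K

end RowsBounded

section UniformBoundedness

open scoped ZeroAtInfty

/-- A null sequence as an element of the Banach space `C₀(ℕ, 𝕜)`, for use of the
Banach–Steinhaus theorem. -/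
def toZeroAtInfty (y : ℕ → 𝕜) (hy : y ∈ c0 𝕜) : C₀(ℕ, 𝕜) where
  toFun := y
  continuous_toFun := continuous_of_discreteTopology
  zero_at_infty' := by rwa [cocompact_eq_cofinite, Nat.cofinite_eq_atTop]

theorem zeroAtInfty_mem_c0 (f : C₀(ℕ, 𝕜)) : ⇑f ∈ c0 𝕜 := by
  have hf := f.zero_at_infty'
  rwa [cocompact_eq_cofinite, Nat.cofinite_eq_atTop] at hf

theorem norm_toZeroAtInfty_le {y : ℕ → 𝕜} (hy : y ∈ c0 𝕜) {M : ℝ} (hM : 0 ≤ M)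
    (h : ∀ k, ‖y k‖ ≤ M) : ‖toZeroAtInfty y hy‖ ≤ M :=
  (BoundedContinuousFunction.norm_le hM).2 h

/-- The coordinate functional `y ↦ y_k` on the Banach space of null sequences. -/
noncomputable def coordCLM (𝕜 : Type*) [RCLike 𝕜] (k : ℕ) : C₀(ℕ, 𝕜) →L[𝕜] 𝕜 :=
  LinearMap.mkContinuous
    { toFun := fun f => f k
      map_add' := fun _ _ => rfl
      map_smul' := fun _ _ => rfl }
    1 fun f => (f.toBCF.norm_coe_le_norm k).trans_eq (one_mul _).symm

theorem coordCLM_apply (k : ℕ) (f : C₀(ℕ, 𝕜)) : coordCLM 𝕜 k f = f k := rfl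

theorem exists_clm_eq_seriesSum_mul {b : ℕ → 𝕜}
    (hb : ∀ y ∈ c0 𝕜, SeriesConv fun k => b k * y k) :
    ∃ φ : C₀(ℕ, 𝕜) →L[𝕜] 𝕜, ∀ f, φ f = seriesSum fun k => b k * f k := by
  have hlim : Tendsto (fun N f => (∑ k ∈ Finset.range N, b k • coordCLM 𝕜 k) f) atTop
      (𝓝 fun f : C₀(ℕ, 𝕜) => seriesSum fun k => b k * f k) := by
    refine tendsto_pi_nhds.2 fun f => ?_
    refine (hb f (zeroAtInfty_mem_c0 f)).tendsto_sum_range.congr fun N => ?_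
    simp only [sum_apply, smul_apply, coordCLM_apply, smul_eq_mul]
  exact ⟨continuousLinearMapOfTendsto _ hlim, fun _ => rfl⟩

theorem sum_norm_le_opNorm {b : ℕ → 𝕜} {φ : C₀(ℕ, 𝕜) →L[𝕜] 𝕜}
    (hφ : ∀ f, φ f = seriesSum fun k => b k * f k) (K : ℕ) :
    ∑ k ∈ Finset.range K, ‖b k‖ ≤ ‖φ‖ := by
  choose σ hσ hbσ using fun k => RCLike.exists_norm_eq_mul_self (b k)
  let y : ℕ → 𝕜 := fun k => if k < K then σ k else 0
  have hy : ∀ k, K ≤ k → y k = 0 := fun k hk => if_neg hk.not_gt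
  have hy_le (k : ℕ) : ‖y k‖ ≤ 1 := by
    simp only [y]
    split_ifs <;> simp [hσ]
  have hval : φ (toZeroAtInfty y (mem_c0_of_eq_zero hy)) =
      ((∑ k ∈ Finset.range K, ‖b k‖ : ℝ) : 𝕜) := by
    rw [hφ, seriesSum_eq_sum_range (m := K) fun k hk => by simp [toZeroAtInfty, hy k hk],
      RCLike.ofReal_sum]
    refine Finset.sum_congr rfl fun k hk => ?_
    simp [toZeroAtInfty, y, Finset.mem_range.1 hk, hbσ, mul_comm]
  calc ∑ k ∈ Finset.range K, ‖b k‖ = ‖φ (toZeroAtInfty y (mem_c0_of_eq_zero hy))‖ := by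
        rw [hval, RCLike.norm_of_nonneg (Finset.sum_nonneg fun _ _ => norm_nonneg _)]
    _ ≤ ‖φ‖ * 1 := φ.le_opNorm_of_le (norm_toZeroAtInfty_le _ zero_le_one hy_le)
    _ = ‖φ‖ := mul_one _

end UniformBoundedness

section MatricesOnNullSequences

variable {B : ℕ → ℕ → 𝕜}

theorem MapsInto.mono {U V V' : Set (ℕ → 𝕜)} (h : MapsInto B U V) (hV : V ⊆ V') :
    MapsInto B U V' :=
  fun x hx => ⟨(h x hx).1, hV (h x hx).2⟩

theorem mapsInto_c0_linf_iff : MapsInto B (c0 𝕜) (linf 𝕜) ↔ RowsBounded B := by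
  refine ⟨fun h => ?_, fun h y hy => ⟨h.seriesConv_mul hy, h.exists_norm_seriesSum_mul_le hy⟩⟩
  choose φ hφ using fun n => exists_clm_eq_seriesSum_mul fun y hy => (h y hy).1 n
  have hbdd (f) : ∃ C, ∀ n, ‖φ n f‖ ≤ C := by
    simp only [hφ]
    exact (h f (zeroAtInfty_mem_c0 f)).2
  obtain ⟨C, hC⟩ := banach_steinhaus hbdd
  exact rowsBounded_iff.2 ⟨C, fun n K => (sum_norm_le_opNorm (hφ n) K).trans (hC n)⟩

theorem MapsInto.col_mem {V : Set (ℕ → 𝕜)} (h : MapsInto B (c0 𝕜) V) (k : ℕ) :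
    (fun n => B n k) ∈ V := by
  simpa only [seriesSum_mul_single] using (h _ (single_mem_c0 k)).2

theorem mapsInto_c0_c_iff :
    MapsInto B (c0 𝕜) (c 𝕜) ↔ RowsBounded B ∧ ∀ k, (fun n => B n k) ∈ c 𝕜 := by
  refine ⟨fun h => ⟨mapsInto_c0_linf_iff.1 (h.mono c_subset_linf), h.col_mem⟩, ?_⟩
  rintro ⟨hB, hcol⟩ y hy
  choose b hb using hcol
  exact ⟨hB.seriesConv_mul hy, _, hB.tendsto_seriesSum_mul hb hy⟩

theorem mapsInto_c0_c0_iff :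
    MapsInto B (c0 𝕜) (c0 𝕜) ↔ RowsBounded B ∧ ∀ k, (fun n => B n k) ∈ c0 𝕜 := by
  refine ⟨fun h => ⟨mapsInto_c0_linf_iff.1 (h.mono (c0_subset_c.trans c_subset_linf)),
    h.col_mem⟩, ?_⟩
  rintro ⟨hB, hcol⟩ y hy
  refine ⟨hB.seriesConv_mul hy, ?_⟩
  simpa [c0, seriesSum] using hB.tendsto_seriesSum_mul hcol hy

end MatricesOnNullSequences

section Triangles

variable {S : ℕ → ℕ → 𝕜} {a y : ℕ → 𝕜}

/-- The sequence `S y` for a triangle `S`. Only the entries on and below the diagonal enter. -/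
noncomputable def triangleApply (S : ℕ → ℕ → 𝕜) (y : ℕ → 𝕜) (j : ℕ) : 𝕜 :=
  ∑ k ∈ Finset.range (j + 1), S j k * y k

/-- The sequence `Sᵗ a = (∑_j s_{jk} a_j)_k`, called `R(a)` in the case of the inverse mean. -/
noncomputable def transposeApply (S : ℕ → ℕ → 𝕜) (a : ℕ → 𝕜) (k : ℕ) : 𝕜 :=
  seriesSum fun j => S j k * a j

/-- The matrix of partial sums `∑_{j<m} s_{jk} a_j` of the series for `Sᵗ a`. -/
noncomputable def partialMatrix (S : ℕ → ℕ → 𝕜) (a : ℕ → 𝕜) (m k : ℕ) : 𝕜 :=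
  ∑ j ∈ Finset.range m, S j k * a j

/-- The triangle of remainders `∑_{j≥m} a_j s_{jk}`, `k ≤ m`, of the series for `Sᵗ a`, called `W^a`
in the case of the inverse mean. -/
noncomputable def tailMatrix (S : ℕ → ℕ → 𝕜) (a : ℕ → 𝕜) (m k : ℕ) : 𝕜 :=
  if k ≤ m then seriesSum fun i => a (m + i) * S (m + i) k else 0

theorem partialMatrix_eq_zero (hS : ∀ j k, j < k → S j k = 0) {m k : ℕ} (h : m ≤ k) :
    partialMatrix S a m k = 0 :=
  Finset.sum_eq_zero fun j hj => by rw [hS j k ((Finset.mem_range.1 hj).trans_le h), zero_mul]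

theorem sum_mul_triangleApply (hS : ∀ j k, j < k → S j k = 0) (m : ℕ) :
    ∑ j ∈ Finset.range m, a j * triangleApply S y j =
      ∑ k ∈ Finset.range m, partialMatrix S a m k * y k := by
  have hrow {j : ℕ} (hj : j < m) :
      triangleApply S y j = ∑ k ∈ Finset.range m, S j k * y k := by
    refine Finset.sum_subset (Finset.range_subset_range.2 hj) fun k _ hk => ?_
    rw [hS j k (by simpa using hk), zero_mul]
  calc ∑ j ∈ Finset.range m, a j * triangleApply S y j
      = ∑ j ∈ Finset.range m, ∑ k ∈ Finset.range m, S j k * a j * y k := by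
        refine Finset.sum_congr rfl fun j hj => ?_
        rw [hrow (Finset.mem_range.1 hj), Finset.mul_sum]
        exact Finset.sum_congr rfl fun k _ => by ring
    _ = ∑ k ∈ Finset.range m, partialMatrix S a m k * y k := by
        rw [Finset.sum_comm]
        simp only [partialMatrix, Finset.sum_mul]

theorem seriesSum_partialMatrix_mul (hS : ∀ j k, j < k → S j k = 0) (m : ℕ) :
    (seriesSum fun k => partialMatrix S a m k * y k) =
      ∑ j ∈ Finset.range m, a j * triangleApply S y j := by
  rw [sum_mul_triangleApply hS]
  exact seriesSum_eq_sum_range fun k hk => by rw [partialMatrix_eq_zero hS hk, zero_mul]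

theorem forall_seriesConv_mul_triangleApply_iff (hS : ∀ j k, j < k → S j k = 0) :
    (∀ y ∈ c0 𝕜, SeriesConv fun j => a j * triangleApply S y j) ↔
      RowsBounded (partialMatrix S a) ∧ ∀ k, SeriesConv fun j => S j k * a j := by
  have hcol (k : ℕ) : (fun m => partialMatrix S a m k) ∈ c 𝕜 ↔ SeriesConv fun j => S j k * a j :=
    seriesConv_iff.symm
  have hrow (y : ℕ → 𝕜) (m : ℕ) : SeriesConv fun k => partialMatrix S a m k * y k :=
    seriesConv_of_eq_zero (m := m) fun k hk => by rw [partialMatrix_eq_zero hS hk, zero_mul]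
  simp only [← hcol, ← mapsInto_c0_c_iff, MapsInto, hrow, implies_true, true_and,
    seriesSum_partialMatrix_mul hS, seriesConv_iff]
  rfl

theorem tailMatrix_eq_sub {m k : ℕ} (h : SeriesConv fun j => S j k * a j) (hk : k ≤ m) :
    tailMatrix S a m k = transposeApply S a k - partialMatrix S a m k := by
  rw [tailMatrix, if_pos hk, transposeApply, partialMatrix, ← h.seriesSum_add_left m]
  simp only [mul_comm]

theorem tendsto_tailMatrix {k : ℕ} (h : SeriesConv fun j => S j k * a j) :
    Tendsto (fun m => tailMatrix S a m k) atTop (𝓝 0) := by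
  have hlim := h.tendsto_sum_range.const_sub (transposeApply S a k)
  rw [transposeApply, sub_self] at hlim
  refine hlim.congr' ?_
  filter_upwards [eventually_ge_atTop k] with m hm using (tailMatrix_eq_sub h hm).symm

theorem rowsBounded_partialMatrix_iff (hS : ∀ j k, j < k → S j k = 0)
    (h : ∀ k, SeriesConv fun j => S j k * a j) :
    RowsBounded (partialMatrix S a) ↔
      RowsBounded (fun _ : ℕ => transposeApply S a) ∧ RowsBounded (tailMatrix S a) := by
  constructor
  · intro hP
    have hT : RowsBounded fun _ : ℕ => transposeApply S a :=
      hP.const_of_tendsto fun k => (h k).tendsto_sum_range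
    refine ⟨hT, hT.of_norm_le_add hP fun m k => ?_⟩
    rcases le_or_gt k m with hk | hk
    · exact tailMatrix_eq_sub (h k) hk ▸ norm_sub_le _ _
    · rw [tailMatrix, if_neg hk.not_ge, norm_zero]
      positivity
  · rintro ⟨hT, hW⟩
    refine hT.of_norm_le_add hW fun m k => ?_
    rcases le_or_gt k m with hk | hk
    · rw [← sub_sub_cancel (transposeApply S a k) (partialMatrix S a m k),
        ← tailMatrix_eq_sub (h k) hk]
      exact norm_sub_le _ _
    · rw [partialMatrix_eq_zero hS hk.le, norm_zero]
      positivity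

theorem seriesSum_mul_triangleApply (hS : ∀ j k, j < k → S j k = 0)
    (hP : RowsBounded (partialMatrix S a)) (h : ∀ k, SeriesConv fun j => S j k * a j)
    (hy : y ∈ c0 𝕜) :
    (seriesSum fun j => a j * triangleApply S y j) =
      seriesSum fun k => transposeApply S a k * y k := by
  refine seriesSum_eq_of_tendsto ?_
  simpa only [seriesSum_partialMatrix_mul hS, transposeApply] using
    hP.tendsto_seriesSum_mul (fun k => (h k).tendsto_sum_range) hy

theorem mapsInto_image_triangleApply_iff (hS : ∀ j k, j < k → S j k = 0) (A : ℕ → ℕ → 𝕜)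
    (V : Set (ℕ → 𝕜)) :
    MapsInto A (triangleApply S '' c0 𝕜) V ↔
      (∀ n k, SeriesConv fun j => S j k * A n j) ∧
        MapsInto (fun n => transposeApply S (A n)) (c0 𝕜) V ∧
        ∀ n, MapsInto (tailMatrix S (A n)) (c0 𝕜) (c0 𝕜) := by
  simp only [MapsInto.eq_def A, Set.forall_mem_image]
  constructor
  · intro h
    have hrow (n) := (forall_seriesConv_mul_triangleApply_iff hS).1 fun y hy => (h hy).1 n
    have hbdd (n) := (rowsBounded_partialMatrix_iff hS (hrow n).2).1 (hrow n).1
    refine ⟨fun n => (hrow n).2, fun y hy => ⟨fun n => (hbdd n).1.seriesConv_mul hy n, ?_⟩,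
      fun n => mapsInto_c0_c0_iff.2 ⟨(hbdd n).2, fun k => tendsto_tailMatrix ((hrow n).2 k)⟩⟩
    simpa only [seriesSum_mul_triangleApply hS (hrow _).1 (hrow _).2 hy] using (h hy).2
  · rintro ⟨hconv, hT, hW⟩ y hy
    have hT_bdd (n) : RowsBounded fun _ : ℕ => transposeApply S (A n) :=
      mapsInto_c0_linf_iff.1 fun y hy => ⟨fun _ => (hT y hy).1 n, _, fun _ => le_rfl⟩
    have hP (n) : RowsBounded (partialMatrix S (A n)) :=
      (rowsBounded_partialMatrix_iff hS (hconv n)).2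
        ⟨hT_bdd n, (mapsInto_c0_c0_iff.1 (hW n)).1⟩
    refine ⟨fun n => (forall_seriesConv_mul_triangleApply_iff hS).2 ⟨hP n, hconv n⟩ y hy, ?_⟩
    simpa only [seriesSum_mul_triangleApply hS (hP _) (hconv _) hy] using (hT y hy).2

end Triangles

section Toeplitz

open PowerSeries

/-- The lower triangular Toeplitz matrix of size `n + 1` with first column `f 0, …, f n`; it
represents multiplication by the power series `∑ f_i Xⁱ` modulo `X ^ (n + 1)`. -/
def toeplitz {K : Type*} [Zero K] (f : ℕ → K) (n : ℕ) : Matrix (Fin (n + 1)) (Fin (n + 1)) K :=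
  Matrix.of fun i j => if (j : ℕ) ≤ i then f (i - j) else 0

theorem det_toeplitz {K : Type*} [CommRing K] (f : ℕ → K) (n : ℕ) :
    (toeplitz f n).det = f 0 ^ (n + 1) := by
  rw [Matrix.det_of_isLowerTriangular]
  · simp [toeplitz]
  · intro i j hij
    exact if_neg (not_le.2 hij)

theorem toeplitz_mulVec_coeff {K : Type*} [CommRing K] (f : ℕ → K) (φ : PowerSeries K) (n : ℕ) :
    (toeplitz f n).mulVec (fun i => coeff i φ) =
      fun i : Fin (n + 1) => coeff i (φ * mk f) := by
  ext i
  rw [coeff_mul,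
    Finset.Nat.sum_antidiagonal_eq_sum_range_succ fun j l => coeff j φ * coeff l (mk f)]
  calc (toeplitz f n).mulVec (fun i => coeff i φ) i
      = ∑ j ∈ Finset.range (n + 1), (if j ≤ i then f (i - j) else 0) * coeff j φ :=
        Fin.sum_univ_eq_sum_range (fun j => (if j ≤ (i : ℕ) then f (i - j) else 0) * coeff j φ) _
    _ = ∑ j ∈ Finset.range (i + 1), (if j ≤ i then f (i - j) else 0) * coeff j φ := by
        refine (Finset.sum_subset (Finset.range_subset_range.2 i.2) fun j _ hj => ?_).symm
        rw [if_neg (by simpa [Nat.lt_succ_iff] using hj), zero_mul]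
    _ = ∑ j ∈ Finset.range (i + 1), coeff j φ * coeff (i - j) (mk f) := by
        refine Finset.sum_congr rfl fun j hj => ?_
        rw [if_pos (Finset.mem_range_succ_iff.1 hj), coeff_mk, mul_comm]

theorem adjugate_toeplitz_last_zero {s : ℕ → 𝕜} (hs : s 0 ≠ 0) (n : ℕ) :
    (toeplitz s n).adjugate (Fin.last n) 0 = s 0 ^ (n + 1) * ((-1) ^ n * D s n) := by
  have hminor : (toeplitz s n).submatrix (Fin.succAbove 0) (Fin.last n).succAbove =
      Matrix.of fun i j : Fin n =>
        if (j : ℕ) ≤ (i : ℕ) + 1 then s ((i : ℕ) + 1 - (j : ℕ)) else 0 := by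
    ext i j
    simp only [Matrix.submatrix_apply, toeplitz, Matrix.of_apply, Fin.succAbove_zero,
      Fin.succAbove_last, Fin.val_succ, Fin.val_castSucc]
  have hpow : s 0 ^ (n + 1) ≠ 0 := pow_ne_zero _ hs
  rw [Matrix.adjugate_fin_succ_eq_det_submatrix, hminor, D, Fin.val_zero, Fin.val_last, zero_add]
  field_simp

theorem coeff_mk_inv {s : ℕ → 𝕜} (hs : s 0 ≠ 0) (n : ℕ) :
    coeff n (mk s)⁻¹ = (-1) ^ n * D s n := by
  have hsystem : (toeplitz s n).mulVec (fun i => coeff i (mk s)⁻¹) = Pi.single 0 1 := by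
    rw [toeplitz_mulVec_coeff, PowerSeries.inv_mul_cancel _ (by simpa using hs)]
    ext i
    simp only [coeff_one, Pi.single_apply, Fin.ext_iff, Fin.val_zero]
  have hcramer := congrFun (congrArg (toeplitz s n).adjugate.mulVec hsystem) (Fin.last n)
  rw [Matrix.mulVec_mulVec, Matrix.adjugate_mul, det_toeplitz, Matrix.smul_mulVec,
    Matrix.one_mulVec, Pi.smul_apply, smul_eq_mul, Fin.val_last, Matrix.mulVec_single_one,
    Matrix.col_apply, adjugate_toeplitz_last_zero hs] at hcramer
  exact mul_left_cancel₀ (pow_ne_zero _ hs) hcramer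

end Toeplitz

section InverseOfMean

open PowerSeries

variable {r s t : ℕ → 𝕜}

theorem diff_injective : Function.Injective (diff : (ℕ → 𝕜) → ℕ → 𝕜) := by
  intro x z h
  ext j
  induction j with
  | zero => exact congrFun h 0
  | succ j ih => simpa [diff, ih] using congrFun h (j + 1)

theorem diff_triangleApply {S : ℕ → ℕ → 𝕜} (hS : ∀ j k, j < k → S j k = 0) (y : ℕ → 𝕜) (j : ℕ) :
    diff (triangleApply S y) j = triangleApply (fun j k => diff (fun i => S i k) j) y j := by
  cases j with
  | zero => rfl
  | succ j =>
    have hext : triangleApply S y j = ∑ k ∈ Finset.range (j + 2), S j k * y k := by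
      rw [Finset.sum_range_succ, hS j (j + 1) j.lt_succ_self, zero_mul, add_zero, triangleApply]
    rw [diff, hext]
    simp only [triangleApply, diff, sub_mul, Finset.sum_sub_distrib]

theorem invEntry_eq_zero {j k : ℕ} (h : j < k) : invEntry r s t j k = 0 :=
  if_neg h.not_ge

theorem diff_invEntry {j k : ℕ} (hk : k ≤ j) :
    diff (fun i => invEntry r s t i k) j = (-1) ^ (j - k) * (D s (j - k) / t j) * r k := by
  cases j with
  | zero =>
    obtain rfl : k = 0 := by omega
    simp [diff, invEntry]
  | succ j =>
    rcases hk.eq_or_lt with rfl | hk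
    · simp [diff, invEntry]
    · rw [Nat.lt_succ_iff] at hk
      rw [diff, invEntry, invEntry, if_pos hk, if_pos (hk.trans j.le_succ), Nat.succ_sub hk,
        Finset.sum_range_succ _ (j - k + 1), add_sub_cancel_left,
        show j - k + 1 + k = j + 1 by omega]

theorem mk_mul_mean (hr : ∀ n, r n ≠ 0) (x : ℕ → 𝕜) :
    (mk fun n => r n * mean r s t x n) = (mk fun k => t k * diff x k) * mk s := by
  ext n
  rw [coeff_mk, coeff_mul, Finset.Nat.sum_antidiagonal_eq_sum_range_succ
    fun k l => coeff k (mk fun k => t k * diff x k) * coeff l (mk s), mean, ← mul_assoc,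
    mul_one_div_cancel (hr n), one_mul]
  refine Finset.sum_congr rfl fun k _ => ?_
  rw [coeff_mk, coeff_mk]
  ring

theorem mk_mul_diff_triangleApply_invEntry (ht : ∀ n, t n ≠ 0) (hs : s 0 ≠ 0) (y : ℕ → 𝕜) :
    (mk fun j => t j * diff (triangleApply (invEntry r s t) y) j) =
      (mk fun k => r k * y k) * (mk s)⁻¹ := by
  ext j
  rw [coeff_mk, coeff_mul, Finset.Nat.sum_antidiagonal_eq_sum_range_succ
    fun k l => coeff k (mk fun k => r k * y k) * coeff l (mk s)⁻¹,
    diff_triangleApply (fun _ _ => invEntry_eq_zero), triangleApply, Finset.mul_sum]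
  refine Finset.sum_congr rfl fun k hk => ?_
  rw [diff_invEntry (Finset.mem_range_succ_iff.1 hk), coeff_mk, coeff_mk_inv hs]
  field_simp [ht j]

theorem mean_triangleApply_invEntry (hr : ∀ n, r n ≠ 0) (ht : ∀ n, t n ≠ 0) (hs : s 0 ≠ 0)
    (y : ℕ → 𝕜) : mean r s t (triangleApply (invEntry r s t) y) = y := by
  have hseries : (mk fun n => r n * mean r s t (triangleApply (invEntry r s t) y) n) =
      mk fun n => r n * y n := by
    rw [mk_mul_mean hr, mk_mul_diff_triangleApply_invEntry ht hs, mul_assoc,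
      PowerSeries.inv_mul_cancel _ (by simpa using hs), mul_one]
  ext n
  exact mul_left_cancel₀ (hr n) (by simpa using congrArg (coeff n) hseries)

theorem triangleApply_invEntry_mean (hr : ∀ n, r n ≠ 0) (ht : ∀ n, t n ≠ 0) (hs : s 0 ≠ 0)
    (x : ℕ → 𝕜) : triangleApply (invEntry r s t) (mean r s t x) = x := by
  have hseries : (mk fun j => t j * diff (triangleApply (invEntry r s t) (mean r s t x)) j) =
      mk fun j => t j * diff x j := by
    rw [mk_mul_diff_triangleApply_invEntry ht hs, mk_mul_mean hr, mul_assoc,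
      PowerSeries.mul_inv_cancel _ (by simpa using hs), mul_one]
  refine diff_injective (funext fun j => ?_)
  exact mul_left_cancel₀ (ht j) (by simpa using congrArg (coeff j) hseries)

theorem c0Mean_eq_image (hr : ∀ n, r n ≠ 0) (ht : ∀ n, t n ≠ 0) (hs : s 0 ≠ 0) :
    c0Mean r s t = triangleApply (invEntry r s t) '' c0 𝕜 :=
  (Set.image_eq_preimage_of_inverse (mean_triangleApply_invEntry hr ht hs)
    (triangleApply_invEntry_mean hr ht hs) ▸ rfl)

end InverseOfMean

section MeanSpace

variable {r s t : ℕ → 𝕜}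

theorem mapsInto_c0Mean_iff (hr : ∀ n, r n ≠ 0) (ht : ∀ n, t n ≠ 0) (hs : s 0 ≠ 0)
    (A : ℕ → ℕ → 𝕜) (V : Set (ℕ → 𝕜)) :
    MapsInto A (c0Mean r s t) V ↔
      (∀ n, RConv r s t (A n)) ∧ MapsInto (fun n => R r s t (A n)) (c0 𝕜) V ∧
        WRowsBounded r s t A ∧ WColsNull r s t A := by
  have hW (n : ℕ) : MapsInto (tailMatrix (invEntry r s t) (A n)) (c0 𝕜) (c0 𝕜) ↔
      ⨆ m, ∑ k ∈ Finset.range (m + 1), ‖W r s t (A n) m k‖ₑ < ∞ ∧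
        ∀ k, Tendsto (fun m => W r s t (A n) m k) atTop (𝓝 0) := by
    have hsum (m : ℕ) : ∑' k, ‖W r s t (A n) m k‖ₑ =
        ∑ k ∈ Finset.range (m + 1), ‖W r s t (A n) m k‖ₑ :=
      tsum_eq_sum fun k hk => by rw [W, if_neg (by simpa using hk), enorm_zero]
    simp only [mapsInto_c0_c0_iff, ← hsum]
    rfl
  rw [c0Mean_eq_image hr ht hs,
    mapsInto_image_triangleApply_iff fun _ _ => invEntry_eq_zero]
  simp only [hW, forall_and]
  rfl

theorem mapsInto_c0Mean_c0_iff (hr : ∀ n, r n ≠ 0) (ht : ∀ n, t n ≠ 0) (hs : s 0 ≠ 0)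
    (A : ℕ → ℕ → 𝕜) :
    MapsInto A (c0Mean r s t) (c0 𝕜) ↔ (∀ n, RConv r s t (A n)) ∧ RRowsBounded r s t A ∧
      RColsNull r s t A ∧ WRowsBounded r s t A ∧ WColsNull r s t A := by
  rw [mapsInto_c0Mean_iff hr ht hs, mapsInto_c0_c0_iff, and_assoc]
  rfl

theorem mapsInto_c0Mean_c_iff (hr : ∀ n, r n ≠ 0) (ht : ∀ n, t n ≠ 0) (hs : s 0 ≠ 0)
    (A : ℕ → ℕ → 𝕜) :
    MapsInto A (c0Mean r s t) (c 𝕜) ↔ (∀ n, RConv r s t (A n)) ∧ RRowsBounded r s t A ∧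
      WRowsBounded r s t A ∧ WColsNull r s t A ∧ RColsConv r s t A := by
  rw [mapsInto_c0Mean_iff hr ht hs, mapsInto_c0_c_iff]
  change _ ∧ (RRowsBounded r s t A ∧ RColsConv r s t A) ∧ _ ↔ _
  tauto

theorem mapsInto_c0Mean_linf_iff (hr : ∀ n, r n ≠ 0) (ht : ∀ n, t n ≠ 0) (hs : s 0 ≠ 0)
    (A : ℕ → ℕ → 𝕜) :
    MapsInto A (c0Mean r s t) (linf 𝕜) ↔ (∀ n, RConv r s t (A n)) ∧ RRowsBounded r s t A ∧
      WRowsBounded r s t A ∧ WColsNull r s t A := by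
  rw [mapsInto_c0Mean_iff hr ht hs, mapsInto_c0_linf_iff]
  rfl

end MeanSpace

section Rearrangement

variable {r s t a : ℕ → 𝕜} {k : ℕ}

theorem WRearr_sub_succ {j : ℕ} (ha : SeriesConv a) (hrearr : SeriesConv (rearrTerm s t a k))
    (hj : k ≤ j) :
    WRearr r s t a j k - WRearr r s t a (j + 1) k = invEntry r s t j k * a j := by
  obtain ⟨i, rfl⟩ := Nat.exists_eq_add_of_le hj
  have htail : tail a (k + i) = a (k + i) + tail a (k + i + 1) := ha.seriesSum_eq_add (k + i)
  have hterm : rearrTerm s t a k (i + 1) =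
      (-1) ^ (i + 1) * (D s (i + 1) / t (i + 1 + k)) * tail a (k + i + 1) := rfl
  rw [invEntry, if_pos hj, ← Finset.sum_mul, WRearr, WRearr,
    show k + i - k + 1 = i + 1 by omega, show k + i + 1 - k + 1 = i + 1 + 1 by omega,
    hrearr.seriesSum_eq_add (i + 1), hterm, htail, Finset.sum_range_succ _ (i + 1)]
  ring

theorem partialMatrix_invEntry_eq_sub {m : ℕ} (ha : SeriesConv a)
    (hrearr : SeriesConv (rearrTerm s t a k)) (hm : k ≤ m) :
    partialMatrix (invEntry r s t) a m k = WRearr r s t a k k - WRearr r s t a m k := by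
  induction m, hm using Nat.le_induction with
  | base => rw [sub_self, partialMatrix_eq_zero (fun _ _ => invEntry_eq_zero) le_rfl]
  | succ m hm ih =>
    rw [partialMatrix, Finset.sum_range_succ, ← WRearr_sub_succ ha hrearr hm, ← partialMatrix, ih]
    exact sub_add_sub_cancel _ _ _

theorem WRearr_self (ha : SeriesConv a) (hrearr : SeriesConv (rearrTerm s t a k)) :
    WRearr r s t a k k = RRearr r s t a k := by
  have htail : tail a k = a k + tail a (k + 1) := ha.seriesSum_eq_add k
  have hterm : rearrTerm s t a k 1 = -(D s 1 / t (k + 1)) * tail a (k + 1) := by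
    rw [rearrTerm, pow_one, neg_one_mul, add_comm 1 k]
  have hD : a k / (s 0 * t k) = D s 0 / t k * a k := by
    rw [D, Matrix.det_fin_zero, zero_add, pow_one, mul_one, div_div, one_div_mul_eq_div]
  rw [WRearr, RRearr, Nat.sub_self, zero_add, hrearr.seriesSum_eq_add 1, hterm, htail, hD,
    Finset.sum_range_one, zero_add, pow_zero, one_mul]
  simp only [add_comm _ 2]
  ring

theorem rearrangement_of_tendsto (ha : SeriesConv a) (hrearr : SeriesConv (rearrTerm s t a k))
    (hlim : Tendsto (fun m => WRearr r s t a m k) atTop (𝓝 0)) :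
    (SeriesConv fun j => invEntry r s t j k * a j) ∧ R r s t a k = RRearr r s t a k ∧
      ∀ m, k ≤ m → W r s t a m k = WRearr r s t a m k := by
  have hpartial : Tendsto (fun m => partialMatrix (invEntry r s t) a m k) atTop
      (𝓝 (WRearr r s t a k k)) := by
    rw [← sub_zero (WRearr r s t a k k)]
    refine (hlim.const_sub _).congr' ?_
    filter_upwards [eventually_ge_atTop k] with m hm
    exact (partialMatrix_invEntry_eq_sub ha hrearr hm).symm
  have hconv : SeriesConv fun j => invEntry r s t j k * a j := seriesConv_of_tendsto hpartial
  have hR : R r s t a k = WRearr r s t a k k := seriesSum_eq_of_tendsto hpartial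
  refine ⟨hconv, hR.trans (WRearr_self ha hrearr), fun m hm => ?_⟩
  calc W r s t a m k = R r s t a k - partialMatrix (invEntry r s t) a m k :=
        tailMatrix_eq_sub hconv hm
    _ = WRearr r s t a m k := by
        rw [hR, partialMatrix_invEntry_eq_sub ha hrearr hm, sub_sub_cancel]

end Rearrangement

end GenMeans

theorem theorem4p11 {𝕜 : Type*} [RCLike 𝕜] (r s t : ℕ → 𝕜)
    (hr : ∀ n, r n ≠ 0) (ht : ∀ n, t n ≠ 0) (hs : s 0 ≠ 0) (A : ℕ → ℕ → 𝕜) :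
    (GenMeans.MapsInto A (GenMeans.c0Mean r s t) (GenMeans.c0 𝕜) ↔
      (∀ n, GenMeans.RConv r s t (A n)) ∧ GenMeans.RRowsBounded r s t A ∧
        GenMeans.RColsNull r s t A ∧ GenMeans.WRowsBounded r s t A ∧
        GenMeans.WColsNull r s t A) ∧
    (GenMeans.MapsInto A (GenMeans.c0Mean r s t) (GenMeans.c 𝕜) ↔
      (∀ n, GenMeans.RConv r s t (A n)) ∧ GenMeans.RRowsBounded r s t A ∧
        GenMeans.WRowsBounded r s t A ∧ GenMeans.WColsNull r s t A ∧
        GenMeans.RColsConv r s t A) ∧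
    (GenMeans.MapsInto A (GenMeans.c0Mean r s t) (GenMeans.linf 𝕜) ↔
      (∀ n, GenMeans.RConv r s t (A n)) ∧ GenMeans.RRowsBounded r s t A ∧
        GenMeans.WRowsBounded r s t A ∧ GenMeans.WColsNull r s t A) ∧
    (∀ n k, GenMeans.SeriesConv (A n) → GenMeans.SeriesConv (GenMeans.rearrTerm s t (A n) k) →
      Tendsto (fun m => GenMeans.WRearr r s t (A n) m k) atTop (𝓝 0) →
      (GenMeans.SeriesConv fun j => GenMeans.invEntry r s t j k * A n j) ∧
        GenMeans.R r s t (A n) k = GenMeans.RRearr r s t (A n) k ∧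
        ∀ m, k ≤ m → GenMeans.W r s t (A n) m k = GenMeans.WRearr r s t (A n) m k) := by
  exact ⟨GenMeans.mapsInto_c0Mean_c0_iff hr ht hs A, GenMeans.mapsInto_c0Mean_c_iff hr ht hs A,
    GenMeans.mapsInto_c0Mean_linf_iff hr ht hs A, fun _ _ => GenMeans.rearrangement_of_tendsto⟩
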